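/- Let $q,k_1,\dots,k_q$ be positive integers and let $\alpha_v,\lambda_v$ ($v=1,\dots,q$) be real constants. Put $$E_v=x^2\frac{d^2}{dx^2}+\alpha_v x\frac{d}{dx}+\lambda_v,\qquad \phi_v=\tfrac12(\alpha_v-1),\qquad \beta_v(m)=m(m+2\phi_v)+\lambda_v ,$$ so that $E_v x^m=\beta_v(m)x^m$. Divide $I=\{1,\dots,q\}$ into $I_1=\{v:\phi_v^2-\lambda_v>0\}$, $I_2=\{v:\phi_v^2-\lambda_v<0\}$ and $I_3=\{v:\phi_v^2-\lambda_v=0\}$. Let $J\subseteq(0,\infty)$ be an open interval (for example $J=(0,\infty)$), and consider on $J$ the iterated Euler equation $$(E_1^{k_1}E_2^{k_2}\cdots E_q^{k_q})\,u=0 ,\qquad (\ast)$$ whose solutions are the real-valued functions $u$ of class $C^{2(k_1+\dots+k_q)}$ on $J$ that satisfy it at every point of $J$. (i) For all real constants $A_{v,l},B_{v,l},C_{v,l},D_{v,l},E_{v,l}$ the function $$\begin{aligned}u(x)={}&\sum_{v\in I_1}\sum_{l=0}^{k_v-1}x^{-\phi_v}\Big[A_{v,l}\,x^{\sqrt{\phi_v^2-\lambda_v}}+B_{v,l}\,x^{-\sqrt{\phi_v^2-\lambda_v}}\Big](\ln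 x)^l\\&+\sum_{v\in I_2}\sum_{l=0}^{k_v-1}x^{-\phi_v}\Big[C_{v,l}\cos\big(\sqrt{\lambda_v-\phi_v^2}\,\ln x\big)+D_{v,l}\sin\big(\sqrt{\lambda_v-\phi_v^2}\,\ln x\big)\Big](\ln x)^l\\&+\sum_{v\in I_3}\sum_{l=0}^{2k_v-1}E_{v,l}\,x^{-\phi_v}(\ln x)^l\end{aligned}\qquad(\ast\ast)$$ is a solution of $(\ast)$ on $J$. (ii) If for $v\ne w$ the polynomials $\beta_v$ and $\beta_w$ have no common root in $\mathbb{C}$, then $(\ast\ast)$ is the general solution of $(\ast)$ on $J$: a function $u:J\to\mathbb{R}$ is a solution of $(\ast)$ if and only if it has the form $(\ast\ast)$ on $J$ for some real constants $A_{v,l},B_{v,l},C_{v,l},D_{v,l},E_{v,l}$. -/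

import Mathlib

noncomputable section

/-- The Euler operator `E u = x² u'' + a x u' + c u`. -/
def eulerOp (a c : ℝ) (u : ℝ → ℝ) : ℝ → ℝ :=
  fun x => x ^ 2 * deriv (deriv u) x + a * x * deriv u x + c * u x

/-- The iterated operator `E₁^{k₁} E₂^{k₂} ⋯ E_q^{k_q}` applied to `u`
(the rightmost factor acts first). -/
def iteratedEuler {q : ℕ} (α lam : Fin q → ℝ) (k : Fin q → ℕ) (u : ℝ → ℝ) : ℝ → ℝ :=
  (List.ofFn fun v : Fin q => (eulerOp (α v) (lam v))^[k v]).foldr (fun T w => T w) u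

/-- `u` is a classical solution on `J` of `E₁^{k₁} ⋯ E_q^{k_q} u = 0`, an equation of order
`2 (k₁ + ⋯ + k_q)`. Only the values of `u` on the open set `J` matter. -/
def IsEulerSolution {q : ℕ} (α lam : Fin q → ℝ) (k : Fin q → ℕ) (J : Set ℝ) (u : ℝ → ℝ) : Prop :=
  ContDiffOn ℝ ((2 * ∑ v, k v : ℕ) : WithTop ℕ∞) u J ∧ ∀ x ∈ J, iteratedEuler α lam k u x = 0

/-- `φ = (a - 1) / 2`. -/
def eulerPhi (a : ℝ) : ℝ := (a - 1) / 2

/-- The characteristic polynomial `β(m) = m (m + 2 φ) + c`, so that `E x^m = β(m) x^m`. -/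
def eulerBeta (a c : ℝ) (m : ℂ) : ℂ := m * (m + 2 * (eulerPhi a : ℂ)) + (c : ℂ)

/-- The discriminant `φ² - c`. -/
def eulerDisc (a c : ℝ) : ℝ := eulerPhi a ^ 2 - c

/-- The explicit combination with constants `A, B, C, D, E` (indexed by the operator `v` and the
power `l` of the logarithm). -/
def eulerCombination {q : ℕ} (α lam : Fin q → ℝ) (k : Fin q → ℕ)
    (A B C D E : Fin q → ℕ → ℝ) (x : ℝ) : ℝ :=
  (∑ v with 0 < eulerDisc (α v) (lam v), ∑ l ∈ Finset.range (k v),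
      x ^ (-eulerPhi (α v)) *
        (A v l * x ^ √(eulerPhi (α v) ^ 2 - lam v)
          + B v l * x ^ (-√(eulerPhi (α v) ^ 2 - lam v))) * Real.log x ^ l)
  + (∑ v with eulerDisc (α v) (lam v) < 0, ∑ l ∈ Finset.range (k v),
      x ^ (-eulerPhi (α v)) *
        (C v l * Real.cos (√(lam v - eulerPhi (α v) ^ 2) * Real.log x)
          + D v l * Real.sin (√(lam v - eulerPhi (α v) ^ 2) * Real.log x)) * Real.log x ^ l)
  + ∑ v with eulerDisc (α v) (lam v) = 0, ∑ l ∈ Finset.range (2 * k v),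
      E v l * x ^ (-eulerPhi (α v)) * Real.log x ^ l

end

/-! Put `θ = x d/dx`. Since `x² u'' = θ² u - θ u`, each Euler operator is `β(θ)`, so the iterated
operator is `P(θ)` with `P = ∏ β_v ^ k_v`, and the problem becomes linear algebra for one
endomorphism of the smooth complex functions on `J` (`isEulerSolution_iff`). Passing to smooth
functions costs nothing, because the leading coefficient `x²` does not vanish on `J`.

Over `ℂ`, `β_v` splits into linear factors, and `(θ - m) ^ n` has kernel spanned by `x ^ m (log x) ^
l`, `l < n`. Membership of these functions in the kernel gives (i). For (ii), the absence of common
roots makes the `β_v` pairwise coprime, so the kernel of `P(θ)` is the sum of the kernels of the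
`β_v(θ) ^ k_v`; distinct roots of one `β_v` are separated in the same way. Taking real parts yields
the real formula. -/

open Polynomial
open scoped ContDiff

noncomputable section

/-! ### The endomorphism `x d/dx` of the smooth functions on `J`. -/

variable {J : Set ℝ}

/-- The smooth complex-valued functions on `J`, extended by zero. -/
def smoothSpace (J : Set ℝ) : Submodule ℂ (ℝ → ℂ) where
  carrier := {f | ContDiffOn ℝ ∞ f J ∧ ∀ x ∉ J, f x = 0}
  add_mem' := by
    rintro f g ⟨hf, hf'⟩ ⟨hg, hg'⟩
    exact ⟨hf.add hg, fun x hx => by simp [hf' x hx, hg' x hx]⟩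
  zero_mem' := ⟨contDiffOn_const, fun _ _ => rfl⟩
  smul_mem' := by
    rintro c f ⟨hf, hf'⟩
    exact ⟨contDiffOn_const.smul hf, fun x hx => by simp [hf' x hx]⟩

namespace smoothSpace

/-- Extension by zero is what makes the values on `J` determine an element. -/
theorem ext_on {f g : smoothSpace J} (h : ∀ x ∈ J, f.1 x = g.1 x) : f = g := by
  apply Subtype.ext
  funext x
  by_cases hx : x ∈ J
  · exact h x hx
  · rw [f.2.2 x hx, g.2.2 x hx]

theorem differentiableAt (hJ : IsOpen J) (f : smoothSpace J) {x : ℝ} (hx : x ∈ J) :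
    DifferentiableAt ℝ f.1 x :=
  (f.2.1.contDiffAt (hJ.mem_nhds hx)).differentiableAt (by simp)

/-- The restriction to `J`, extended by zero, of a function that is smooth on `J`. -/
def restrict (f : ℝ → ℂ) (hf : ContDiffOn ℝ ∞ f J) : smoothSpace J :=
  ⟨J.indicator f, hf.congr fun x hx => by simp [hx], fun x hx => by simp [hx]⟩

theorem restrict_apply (f : ℝ → ℂ) (hf : ContDiffOn ℝ ∞ f J) {x : ℝ} (hx : x ∈ J) :
    (restrict f hf).1 x = f x := by
  simp [restrict, hx]

/-- The derivation `x d/dx` on the smooth functions on an open set. -/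
def theta (hJ : IsOpen J) : Module.End ℂ (smoothSpace J) where
  toFun f := restrict (fun x => (x : ℂ) * deriv f.1 x) <|
    (Complex.ofRealCLM.contDiff.contDiffOn).mul
      ((contDiffOn_infty_iff_deriv_of_isOpen hJ).1 f.2.1).2
  map_add' f g := ext_on fun x hx => by
    have : deriv (f.1 + g.1) x = deriv f.1 x + deriv g.1 x :=
      deriv_add (differentiableAt hJ f hx) (differentiableAt hJ g hx)
    simp [restrict, hx, this, mul_add]
  map_smul' c f := ext_on fun x hx => by
    have : deriv (c • f.1) x = c • deriv f.1 x :=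
      deriv_const_smul c (differentiableAt hJ f hx)
    simp [restrict, hx, this]
    ring

theorem theta_apply (hJ : IsOpen J) (f : smoothSpace J) {x : ℝ} (hx : x ∈ J) :
    (theta hJ f).1 x = x * deriv f.1 x :=
  by
  simp [theta, restrict, hx]

theorem theta_eq_of_hasDerivAt (hJ : IsOpen J) {f : smoothSpace J} {g : ℝ → ℂ} {x : ℝ} {d : ℂ}
    (hx : x ∈ J) (hfg : ∀ y ∈ J, f.1 y = g y) (hg : HasDerivAt g d x) :
    (theta hJ f).1 x = x * d := by
  rw [theta_apply hJ f hx]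
  congr 1
  refine (hg.congr_of_eventuallyEq ?_).deriv
  filter_upwards [hJ.mem_nhds hx] with y hy using hfg y hy

/-! ### The kernel of `(θ - m) ^ n`. -/

/-- The function `x ^ m * (log x) ^ l`, written through the exponential. -/
def logPow (m : ℂ) (l : ℕ) (x : ℝ) : ℂ :=
  Complex.exp (m * (Real.log x : ℂ)) * (Real.log x : ℂ) ^ l

theorem contDiffOn_logPow (hpos : J ⊆ Set.Ioi 0) (m : ℂ) (l : ℕ) :
    ContDiffOn ℝ ∞ (logPow m l) J := by
  have h : ContDiffOn ℝ ∞ (fun x => (Real.log x : ℂ)) J :=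
    Complex.ofRealCLM.contDiff.comp_contDiffOn
      (contDiffOn_id.log fun x hx => (ne_of_gt (hpos hx)))
  exact (contDiffOn_const.mul h).cexp.mul (h.pow l)

theorem hasDerivAt_log_ofReal {x : ℝ} (hx : x ≠ 0) :
    HasDerivAt (fun x : ℝ => (Real.log x : ℂ)) ((x : ℂ)⁻¹) x := by
  have := (Real.hasDerivAt_log hx).ofReal_comp
  simpa using this

theorem hasDerivAt_logPow {x : ℝ} (hx : x ≠ 0) (m : ℂ) (l : ℕ) :
    HasDerivAt (logPow m l)
      ((x : ℂ)⁻¹ * (m * logPow m l x + l * logPow m (l - 1) x)) x := by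
  have h := hasDerivAt_log_ofReal hx
  have h1 := ((h.const_mul m).cexp).mul (h.pow l)
  refine h1.congr_deriv ?_
  simp only [logPow, Pi.pow_apply]
  ring

/-- The function `x ^ m * (log x) ^ l` as an element of the space of smooth functions. -/
def logMonomial (hpos : J ⊆ Set.Ioi 0) (m : ℂ) (l : ℕ) : smoothSpace J :=
  restrict (logPow m l) (contDiffOn_logPow hpos m l)

theorem logMonomial_apply (hpos : J ⊆ Set.Ioi 0) (m : ℂ) (l : ℕ) {x : ℝ} (hx : x ∈ J) :
    (logMonomial hpos m l).1 x = logPow m l x :=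
  restrict_apply _ _ hx

theorem aeval_X_sub_C_apply (hJ : IsOpen J) (m : ℂ) (f : smoothSpace J) :
    aeval (theta hJ) (X - C m) f = theta hJ f - m • f := by
  simp [Module.algebraMap_end_apply]

/-- On `x ^ m` times a polynomial in `log x`, `θ - m` differentiates that polynomial. For `l = 0`
the truncated `l - 1` is harmless, as its coefficient is zero. -/
theorem aeval_X_sub_C_logMonomial (hJ : IsOpen J) (hpos : J ⊆ Set.Ioi 0) (m : ℂ) (l : ℕ) :
    aeval (theta hJ) (X - C m) (logMonomial hpos m l) = (l : ℂ) • logMonomial hpos m (l - 1) := by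
  rw [aeval_X_sub_C_apply]
  refine ext_on fun x hx => ?_
  have hx0 : x ≠ 0 := ne_of_gt (hpos hx)
  have h := theta_eq_of_hasDerivAt hJ hx (fun y hy => logMonomial_apply hpos m l hy)
    (hasDerivAt_logPow hx0 m l)
  have hx0' : (x : ℂ) ≠ 0 := by exact_mod_cast hx0
  change (theta hJ (logMonomial hpos m l)).1 x - m * (logMonomial hpos m l).1 x
    = l * (logMonomial hpos m (l - 1)).1 x
  rw [h, logMonomial_apply hpos m l hx, logMonomial_apply hpos m _ hx]
  field_simp
  ring

theorem aeval_X_sub_C_pow_logMonomial (hJ : IsOpen J) (hpos : J ⊆ Set.Ioi 0) (m : ℂ) :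
    ∀ {n l : ℕ}, l < n → aeval (theta hJ) ((X - C m) ^ n) (logMonomial hpos m l) = 0
  | n + 1, l, h => by
    rw [pow_succ, aeval_mul, Module.End.mul_apply, aeval_X_sub_C_logMonomial hJ hpos, map_smul]
    rcases l with _ | l
    · simp
    · rw [Nat.add_sub_cancel, aeval_X_sub_C_pow_logMonomial hJ hpos m (by omega), smul_zero]

/-- The integrating factor `x ^ (-m)` turns the equation into a vanishing derivative; connectedness
of `J` then gives one constant. -/
theorem eq_smul_of_aeval_X_sub_C_eq_zero (hJ : IsOpen J) (hc : J.OrdConnected)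
    (hpos : J ⊆ Set.Ioi 0) {m : ℂ} {f : smoothSpace J} (hf : aeval (theta hJ) (X - C m) f = 0) :
    ∃ c : ℂ, f = c • logMonomial hpos m 0 := by
  have hd : ∀ x ∈ J, HasDerivAt (fun y => f.1 y * logPow (-m) 0 y) 0 x := by
    intro x hx
    have hx0 : x ≠ 0 := ne_of_gt (hpos hx)
    have hx0' : (x : ℂ) ≠ 0 := by exact_mod_cast hx0
    have h1 := (differentiableAt hJ f hx).hasDerivAt.mul (hasDerivAt_logPow hx0 (-m) 0)
    refine h1.congr_deriv ?_
    have h2 : (x : ℂ) * deriv f.1 x - m * f.1 x = 0 := by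
      rw [← theta_apply hJ f hx]
      rw [aeval_X_sub_C_apply] at hf
      exact congrFun (congrArg Subtype.val hf) x
    have h3 : deriv f.1 x = (x : ℂ)⁻¹ * (m * f.1 x) := by
      field_simp
      linear_combination h2
    rw [h3]
    push_cast
    ring
  obtain ⟨c, hcst⟩ := hJ.exists_is_const_of_deriv_eq_zero hc.isPreconnected
    (fun x hx => (hd x hx).differentiableAt.differentiableWithinAt) (fun x hx => (hd x hx).deriv)
  refine ⟨c, ext_on fun x hx => ?_⟩
  change f.1 x = c * (logMonomial hpos m 0).1 x
  rw [logMonomial_apply hpos m 0 hx, ← hcst x hx]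
  have : Complex.exp (-m * (Real.log x : ℂ)) * Complex.exp (m * (Real.log x : ℂ)) = 1 := by
    rw [← Complex.exp_add]
    simp
  simp only [logPow, pow_zero, mul_one]
  rw [mul_assoc, this, mul_one]

/-- The kernel of `(x d/dx - m) ^ n` is spanned by `x ^ m * (log x) ^ l` with `l < n`. -/
theorem exists_eq_sum_of_aeval_X_sub_C_pow_eq_zero (hJ : IsOpen J) (hc : J.OrdConnected)
    (hpos : J ⊆ Set.Ioi 0) {m : ℂ} (n : ℕ) {f : smoothSpace J}
    (hf : aeval (theta hJ) ((X - C m) ^ n) f = 0) :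
    ∃ c : ℕ → ℂ, f = ∑ l ∈ Finset.range n, c l • logMonomial hpos m l := by
  induction n generalizing f with
  | zero => exact ⟨0, by simpa using hf⟩
  | succ n ih =>
    rw [pow_succ, aeval_mul, Module.End.mul_apply] at hf
    obtain ⟨c, hcf⟩ := ih hf
    -- Termwise integration in `log x`: `g` has the same image under `θ - m` as `f`.
    set g := ∑ l ∈ Finset.range n, (c l / (l + 1)) • logMonomial hpos m (l + 1) with hg
    have h0 : aeval (theta hJ) (X - C m) (f - g) = 0 := by
      rw [map_sub, hcf, hg, map_sum, sub_eq_zero]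
      refine Finset.sum_congr rfl fun l _ => ?_
      rw [map_smul, aeval_X_sub_C_logMonomial, smul_smul, Nat.add_sub_cancel]
      have : (l : ℂ) + 1 ≠ 0 := Nat.cast_add_one_ne_zero l
      push_cast
      rw [div_mul_cancel₀ _ this]
    obtain ⟨d, hd⟩ := eq_smul_of_aeval_X_sub_C_eq_zero hJ hc hpos h0
    refine ⟨fun l => if l = 0 then d else c (l - 1) / l, ?_⟩
    rw [Finset.sum_range_succ', eq_add_of_sub_eq hd, hg, add_comm]
    simp

theorem aeval_of_dvd (hJ : IsOpen J) {p r : ℂ[X]} (h : p ∣ r) {f : smoothSpace J}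
    (hf : aeval (theta hJ) p f = 0) : aeval (theta hJ) r f = 0 := by
  obtain ⟨s, rfl⟩ := h
  rw [mul_comm, aeval_mul, Module.End.mul_apply, hf, map_zero]

end smoothSpace

/-! ### Splitting a kernel along coprime factors. -/

/-- A vector killed by a product of pairwise coprime polynomials in an endomorphism is a sum of
vectors killed by the factors. -/
theorem exists_eq_sum_of_aeval_prod_eq_zero {ι K M : Type*} [Field K] [AddCommGroup M]
    [Module K M] (T : Module.End K M) (p : ι → K[X]) (s : Finset ι)
    (hp : (s : Set ι).Pairwise fun i j => IsCoprime (p i) (p j)) {f : M}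
    (hf : aeval T (∏ i ∈ s, p i) f = 0) :
    ∃ g : ι → M, (∀ i ∈ s, aeval T (p i) (g i) = 0) ∧ f = ∑ i ∈ s, g i := by
  classical
  induction s using Finset.induction_on generalizing f with
  | empty => exact ⟨0, by simp, by simpa using hf⟩
  | insert i s hi ih =>
    have hcop : IsCoprime (p i) (∏ j ∈ s, p j) :=
      IsCoprime.prod_right fun j hj =>
        hp (by simp) (by simp [hj]) (fun h => hi (h ▸ hj))
    rw [Finset.prod_insert hi] at hf
    have hmem : f ∈ LinearMap.ker (aeval T (p i)) ⊔ LinearMap.ker (aeval T (∏ j ∈ s, p j)) := by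
      rw [sup_ker_aeval_eq_ker_aeval_mul_of_coprime T hcop]
      exact hf
    obtain ⟨a, ha, b, hb, rfl⟩ := Submodule.mem_sup.1 hmem
    obtain ⟨g, hg, rfl⟩ := ih (hp.mono (by simp)) hb
    refine ⟨Function.update g i a, ?_, ?_⟩
    · intro j hj
      by_cases hji : j = i
      · subst hji
        simpa using ha
      · rw [Function.update_of_ne hji]
        exact hg j (Finset.mem_of_mem_insert_of_ne hj hji)
    · rw [Finset.sum_insert hi, Function.update_self]
      congr 1
      refine Finset.sum_congr rfl fun j hj => ?_
      rw [Function.update_of_ne (ne_of_mem_of_not_mem hj hi)]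

/-! ### Regularity of solutions. -/

theorem ContDiffOn.deriv_of_add_one {u : ℝ → ℝ} (hJ : IsOpen J) {n : ℕ}
    (h : ContDiffOn ℝ ((n + 1 : ℕ) : WithTop ℕ∞) u J) :
    ContDiffOn ℝ (n : WithTop ℕ∞) (deriv u) J :=
  h.deriv_of_isOpen hJ (by push_cast; exact le_rfl)

theorem contDiffOn_eulerOp (hJ : IsOpen J) (a c : ℝ) {n : ℕ} {u : ℝ → ℝ}
    (hu : ContDiffOn ℝ ((n + 2 : ℕ) : WithTop ℕ∞) u J) :
    ContDiffOn ℝ (n : WithTop ℕ∞) (eulerOp a c u) J := by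
  have h1 : ContDiffOn ℝ ((n + 1 : ℕ) : WithTop ℕ∞) (deriv u) J := hu.deriv_of_add_one hJ
  have h2 := h1.deriv_of_add_one hJ
  have h1' : ContDiffOn ℝ (n : WithTop ℕ∞) (deriv u) J := h1.of_le (by norm_cast; omega)
  have h0 : ContDiffOn ℝ (n : WithTop ℕ∞) u J := hu.of_le (by norm_cast; omega)
  exact (((contDiffOn_id.pow 2).mul h2).add ((contDiffOn_const.mul contDiffOn_id).mul h1')).add
    (contDiffOn_const.mul h0)

/-- Bootstrapping: solving for `u''`, by division by `x²`, shows that `u''` is as smooth as `u'`, so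
each round gains a derivative. -/
theorem contDiffOn_infty_of_eulerOp (hJ : IsOpen J) (hpos : J ⊆ Set.Ioi 0) (a c : ℝ) {u : ℝ → ℝ}
    (hu : ContDiffOn ℝ 2 u J) (h : ContDiffOn ℝ ∞ (eulerOp a c u) J) : ContDiffOn ℝ ∞ u J := by
  rw [contDiffOn_infty]
  have key : ∀ n : ℕ, ContDiffOn ℝ ((n + 2 : ℕ) : WithTop ℕ∞) u J := by
    intro n
    induction n with
    | zero => exact_mod_cast hu
    | succ n ih =>
      have h1 : ContDiffOn ℝ ((n + 1 : ℕ) : WithTop ℕ∞) (deriv u) J := ih.deriv_of_add_one hJ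
      have h0 : ContDiffOn ℝ ((n + 1 : ℕ) : WithTop ℕ∞) u J := ih.of_le (by norm_cast; omega)
      have h2 : ContDiffOn ℝ ((n + 1 : ℕ) : WithTop ℕ∞) (deriv (deriv u)) J := by
        refine ContDiffOn.congr (f := fun x => (eulerOp a c u x - a * x * deriv u x - c * u x)
          / x ^ 2) ?_ ?_
        · refine ContDiffOn.div ?_ (contDiffOn_id.pow 2) fun x hx => pow_ne_zero 2 (ne_of_gt (hpos hx))
          exact ((contDiffOn_infty.1 h _).sub ((contDiffOn_const.mul contDiffOn_id).mul h1)).sub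
            (contDiffOn_const.mul h0)
        · intro x hx
          have hx0 : x ≠ 0 := ne_of_gt (hpos hx)
          simp only [eulerOp]
          field_simp
          ring
      have h1' : ContDiffOn ℝ (((n + 1 : ℕ) : WithTop ℕ∞) + 1) (deriv u) J :=
        (contDiffOn_succ_iff_deriv_of_isOpen hJ).2
          ⟨h1.differentiableOn (by norm_cast), by simp, h2⟩
      have h0' : ContDiffOn ℝ (((n + 1 : ℕ) : WithTop ℕ∞) + 1 + 1) u J :=
        (contDiffOn_succ_iff_deriv_of_isOpen hJ).2
          ⟨h0.differentiableOn (by norm_cast), by simp, h1'⟩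
      exact_mod_cast h0'
  exact fun n => (key n).of_le (by norm_cast; omega)

theorem contDiffOn_iterate_eulerOp (hJ : IsOpen J) (a c : ℝ) (k : ℕ) {n : ℕ} {u : ℝ → ℝ}
    (hu : ContDiffOn ℝ ((n + 2 * k : ℕ) : WithTop ℕ∞) u J) :
    ContDiffOn ℝ (n : WithTop ℕ∞) ((eulerOp a c)^[k] u) J := by
  induction k generalizing u with
  | zero => exact hu
  | succ k ih => exact ih (contDiffOn_eulerOp hJ a c hu)

theorem contDiffOn_infty_of_iterate_eulerOp (hJ : IsOpen J) (hpos : J ⊆ Set.Ioi 0) (a c : ℝ)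
    (k : ℕ) {u : ℝ → ℝ} (hu : ContDiffOn ℝ ((2 * k : ℕ) : WithTop ℕ∞) u J)
    (h : ContDiffOn ℝ ∞ ((eulerOp a c)^[k] u) J) : ContDiffOn ℝ ∞ u J := by
  induction k generalizing u with
  | zero => exact h
  | succ k ih =>
    refine contDiffOn_infty_of_eulerOp hJ hpos a c (hu.of_le (by norm_cast; omega)) ?_
    exact ih (contDiffOn_eulerOp hJ a c hu) h

theorem iteratedEuler_succ {q : ℕ} (α lam : Fin (q + 1) → ℝ) (k : Fin (q + 1) → ℕ) (u : ℝ → ℝ) :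
    iteratedEuler α lam k u = (eulerOp (α 0) (lam 0))^[k 0]
      (iteratedEuler (fun v => α v.succ) (fun v => lam v.succ) (fun v => k v.succ) u) := by
  simp [iteratedEuler, List.ofFn_succ]

theorem contDiffOn_iteratedEuler (hJ : IsOpen J) {q : ℕ} (α lam : Fin q → ℝ) (k : Fin q → ℕ)
    {n : ℕ} {u : ℝ → ℝ} (hu : ContDiffOn ℝ ((n + 2 * ∑ v, k v : ℕ) : WithTop ℕ∞) u J) :
    ContDiffOn ℝ (n : WithTop ℕ∞) (iteratedEuler α lam k u) J := by
  induction q generalizing n with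
  | zero => simpa [iteratedEuler] using hu
  | succ q ih =>
    rw [iteratedEuler_succ]
    refine contDiffOn_iterate_eulerOp hJ _ _ _
      (ih (fun v => α v.succ) (fun v => lam v.succ) (fun v => k v.succ) (hu.of_le ?_))
    rw [Fin.sum_univ_succ]
    norm_cast
    omega

/-- The outermost power is removed first: what it acts on still has enough derivatives to be
bootstrapped to a smooth function. -/
theorem contDiffOn_infty_of_iteratedEuler (hJ : IsOpen J) (hpos : J ⊆ Set.Ioi 0) {q : ℕ}
    (α lam : Fin q → ℝ) (k : Fin q → ℕ) {u : ℝ → ℝ}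
    (hu : ContDiffOn ℝ ((2 * ∑ v, k v : ℕ) : WithTop ℕ∞) u J)
    (h : ContDiffOn ℝ ∞ (iteratedEuler α lam k u) J) : ContDiffOn ℝ ∞ u J := by
  induction q with
  | zero => simpa [iteratedEuler] using h
  | succ q ih =>
    rw [Fin.sum_univ_succ] at hu
    rw [iteratedEuler_succ] at h
    refine ih (fun v => α v.succ) (fun v => lam v.succ) (fun v => k v.succ) (hu.of_le (by norm_cast; omega)) ?_
    refine contDiffOn_infty_of_iterate_eulerOp hJ hpos _ _ _
      (contDiffOn_iteratedEuler hJ _ _ (fun v => k v.succ) ?_) h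
    exact hu.of_le (by norm_cast; omega)

/-! ### Characteristic polynomials and the translation to `θ`. -/

/-- The characteristic polynomial of an Euler operator. -/
def eulerPoly (a c : ℝ) : ℂ[X] := X * (X + C (2 * (eulerPhi a : ℂ))) + C (c : ℂ)

theorem eval_eulerPoly (a c : ℝ) (m : ℂ) : (eulerPoly a c).eval m = eulerBeta a c m := by
  simp [eulerPoly, eulerBeta]

theorem eulerPoly_eq_mul (a c : ℝ) {s : ℂ} (hs : s ^ 2 = (eulerDisc a c : ℂ)) :
    eulerPoly a c = (X - C (-(eulerPhi a : ℂ) + s)) * (X - C (-(eulerPhi a : ℂ) - s)) := by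
  have hc : (c : ℂ) = (eulerPhi a : ℂ) ^ 2 - s ^ 2 := by
    rw [hs, eulerDisc]
    push_cast
    ring
  rw [eulerPoly, hc]
  simp only [map_add, map_sub, map_mul, map_neg, map_pow, map_ofNat]
  ring

theorem isCoprime_eulerPoly {a c a' c' : ℝ}
    (h : ¬ ∃ m : ℂ, eulerBeta a c m = 0 ∧ eulerBeta a' c' m = 0) :
    IsCoprime (eulerPoly a c) (eulerPoly a' c') := by
  rw [isCoprime_iff_aeval_ne_zero_of_isAlgClosed ℂ ℂ]
  intro m
  rw [coe_aeval_eq_eval, eval_eulerPoly, eval_eulerPoly]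
  by_contra! hm
  exact h ⟨m, hm⟩

namespace smoothSpace

/-- `f` agrees on `J` with the real-valued function `u`. -/
def Represents (f : smoothSpace J) (u : ℝ → ℝ) : Prop := ∀ x ∈ J, f.1 x = (u x : ℂ)

theorem Represents.contDiffOn {f : smoothSpace J} {u : ℝ → ℝ} (h : Represents f u) :
    ContDiffOn ℝ ∞ u J :=
  (Complex.reCLM.contDiff.comp_contDiffOn f.2.1).congr fun x hx => by simp [h x hx]

theorem exists_represents {u : ℝ → ℝ} (h : ContDiffOn ℝ ∞ u J) :
    ∃ f : smoothSpace J, Represents f u :=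
  ⟨restrict (fun x => (u x : ℂ)) (Complex.ofRealCLM.contDiff.comp_contDiffOn h),
    fun _ hx => restrict_apply _ _ hx⟩

theorem Represents.theta (hJ : IsOpen J) {f : smoothSpace J} {u : ℝ → ℝ} (h : Represents f u) :
    Represents (theta hJ f) fun x => x * deriv u x := fun x hx => by
  have hu : DifferentiableAt ℝ u x :=
    (h.contDiffOn.contDiffAt (hJ.mem_nhds hx)).differentiableAt (by simp)
  rw [theta_eq_of_hasDerivAt hJ hx h hu.hasDerivAt.ofReal_comp]
  push_cast
  rfl

/-- This is `θ² u = x² u'' + x u'` together with `2φ + 1 = a`. -/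
theorem Represents.eulerOp (hJ : IsOpen J) (a c : ℝ) {f : smoothSpace J} {u : ℝ → ℝ}
    (h : Represents f u) :
    Represents (aeval (smoothSpace.theta hJ) (eulerPoly a c) f) (eulerOp a c u) := by
  intro x hx
  have h1 := h.theta hJ
  have h2 := h1.theta hJ x hx
  have hd : DifferentiableAt ℝ (deriv u) x :=
    ((((contDiffOn_infty_iff_deriv_of_isOpen hJ).1 h.contDiffOn).2.contDiffAt
      (hJ.mem_nhds hx))).differentiableAt (by simp)
  have h3 : deriv (fun x => x * deriv u x) x = deriv u x + x * deriv (deriv u) x := by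
    have := ((hasDerivAt_id x).mul hd.hasDerivAt).deriv
    simpa using! this
  simp only [h3] at h2
  have h4 : aeval (smoothSpace.theta hJ) (eulerPoly a c) f
      = smoothSpace.theta hJ (smoothSpace.theta hJ f)
        + (2 * (eulerPhi a : ℂ)) • smoothSpace.theta hJ f + (c : ℂ) • f := by
    simp only [eulerPoly, map_add, map_mul, aeval_X, aeval_C, LinearMap.add_apply,
      Module.End.mul_apply, Module.algebraMap_end_apply, map_smul]
    simp only [mul_smul]
    rw [smul_comm (eulerPhi a : ℂ)]
  rw [h4]
  change (smoothSpace.theta hJ (smoothSpace.theta hJ f)).1 x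
        + (2 * (eulerPhi a : ℂ)) * (smoothSpace.theta hJ f).1 x + (c : ℂ) * f.1 x = _
  rw [h2, h1 x hx, h x hx]
  simp only [_root_.eulerOp, eulerPhi]
  push_cast
  ring

theorem Represents.iterate_eulerOp (hJ : IsOpen J) (a c : ℝ) (k : ℕ) {f : smoothSpace J}
    {u : ℝ → ℝ} (h : Represents f u) :
    Represents (aeval (smoothSpace.theta hJ) (eulerPoly a c ^ k) f)
      ((_root_.eulerOp a c)^[k] u) := by
  induction k with
  | zero => simpa using h
  | succ k ih =>
    rw [pow_succ', aeval_mul, Module.End.mul_apply, Function.iterate_succ_apply']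
    exact ih.eulerOp hJ a c

theorem Represents.iteratedEuler (hJ : IsOpen J) {q : ℕ} (α lam : Fin q → ℝ) (k : Fin q → ℕ)
    {f : smoothSpace J} {u : ℝ → ℝ} (h : Represents f u) :
    Represents (aeval (smoothSpace.theta hJ) (∏ v, eulerPoly (α v) (lam v) ^ k v) f)
      (iteratedEuler α lam k u) := by
  induction q with
  | zero => simpa [_root_.iteratedEuler] using h
  | succ q ih =>
    rw [Fin.prod_univ_succ, aeval_mul, Module.End.mul_apply, iteratedEuler_succ]
    exact (ih _ _ _).iterate_eulerOp hJ _ _ _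

end smoothSpace

open smoothSpace

theorem isEulerSolution_iff (hJ : IsOpen J) (hpos : J ⊆ Set.Ioi 0) {q : ℕ}
    (α lam : Fin q → ℝ) (k : Fin q → ℕ) (u : ℝ → ℝ) :
    IsEulerSolution α lam k J u ↔ ∃ f : smoothSpace J, Represents f u ∧
      aeval (theta hJ) (∏ v, eulerPoly (α v) (lam v) ^ k v) f = 0 := by
  constructor
  · rintro ⟨hu, h⟩
    obtain ⟨f, hf⟩ := exists_represents (contDiffOn_infty_of_iteratedEuler hJ hpos α lam k hu
      (contDiffOn_const.congr h))
    refine ⟨f, hf, ext_on fun x hx => ?_⟩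
    rw [hf.iteratedEuler hJ α lam k x hx, h x hx]
    rfl
  · rintro ⟨f, hf, h⟩
    refine ⟨contDiffOn_infty.1 hf.contDiffOn _, fun x hx => ?_⟩
    have := hf.iteratedEuler hJ α lam k x hx
    rw [h] at this
    exact Complex.ofReal_eq_zero.1 this.symm

/-! ### Passing between complex and real forms. -/

namespace smoothSpace

theorem logPow_ofReal (m : ℝ) (l : ℕ) {x : ℝ} (hx : 0 < x) :
    logPow (m : ℂ) l x = ((x ^ m * Real.log x ^ l : ℝ) : ℂ) := by
  rw [Real.rpow_def_of_pos hx, logPow, mul_comm (m : ℂ)]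
  push_cast
  rfl

theorem logPow_ofReal_add_mul_I (m s : ℝ) (l : ℕ) {x : ℝ} (hx : 0 < x) :
    logPow (m + s * Complex.I) l x = ((x ^ m * Real.log x ^ l : ℝ) : ℂ) *
      ((Real.cos (s * Real.log x) : ℝ) + (Real.sin (s * Real.log x) : ℝ) * Complex.I) := by
  rw [Complex.ofReal_cos, Complex.ofReal_sin, ← Complex.exp_mul_I, ← logPow_ofReal m l hx, logPow,
    logPow, add_mul, Complex.exp_add]
  push_cast
  ring_nf

end smoothSpace

/-- The part of the explicit combination that belongs to a single operator. -/
def eulerPart (a c : ℝ) (k : ℕ) (A B C D E : ℕ → ℝ) (x : ℝ) : ℝ :=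
  (if 0 < eulerDisc a c then ∑ l ∈ Finset.range k,
      x ^ (-eulerPhi a) * (A l * x ^ √(eulerPhi a ^ 2 - c) + B l * x ^ (-√(eulerPhi a ^ 2 - c)))
        * Real.log x ^ l else 0)
  + (if eulerDisc a c < 0 then ∑ l ∈ Finset.range k,
      x ^ (-eulerPhi a) * (C l * Real.cos (√(c - eulerPhi a ^ 2) * Real.log x)
        + D l * Real.sin (√(c - eulerPhi a ^ 2) * Real.log x)) * Real.log x ^ l else 0)
  + (if eulerDisc a c = 0 then ∑ l ∈ Finset.range (2 * k),
      E l * x ^ (-eulerPhi a) * Real.log x ^ l else 0)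

theorem eulerCombination_eq_sum {q : ℕ} (α lam : Fin q → ℝ) (k : Fin q → ℕ)
    (A B C D E : Fin q → ℕ → ℝ) (x : ℝ) :
    eulerCombination α lam k A B C D E x
      = ∑ v, eulerPart (α v) (lam v) (k v) (A v) (B v) (C v) (D v) (E v) x := by
  simp only [eulerCombination, eulerPart, Finset.sum_add_distrib, Finset.sum_filter]

theorem sq_sqrt_eulerDisc {a c : ℝ} (h : 0 < eulerDisc a c) :
    ((√(eulerPhi a ^ 2 - c) : ℝ) : ℂ) ^ 2 = (eulerDisc a c : ℂ) := by
  rw [eulerDisc] at h ⊢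
  rw [← Complex.ofReal_pow, Real.sq_sqrt h.le]

theorem sq_sqrt_neg_eulerDisc {a c : ℝ} (h : eulerDisc a c < 0) :
    (((√(c - eulerPhi a ^ 2) : ℝ) : ℂ) * Complex.I) ^ 2 = (eulerDisc a c : ℂ) := by
  rw [eulerDisc] at h ⊢
  rw [mul_pow, ← Complex.ofReal_pow, Real.sq_sqrt (by linarith), Complex.I_sq]
  push_cast
  ring

theorem aeval_mul_pow_sum (hJ : IsOpen J) (hpos : J ⊆ Set.Ioi 0) (m m' : ℂ) (k : ℕ)
    (d d' : ℕ → ℂ) :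
    aeval (theta hJ) (((X - C m) * (X - C m')) ^ k)
      (∑ l ∈ Finset.range k, (d l • logMonomial hpos m l + d' l • logMonomial hpos m' l)) = 0 := by
  rw [map_sum]
  refine Finset.sum_eq_zero fun l hl => ?_
  have h := Finset.mem_range.1 hl
  rw [map_add, map_smul, map_smul, mul_pow,
    aeval_of_dvd hJ (dvd_mul_right _ _) (aeval_X_sub_C_pow_logMonomial hJ hpos m h),
    aeval_of_dvd hJ (dvd_mul_left _ _) (aeval_X_sub_C_pow_logMonomial hJ hpos m' h)]
  simp

theorem exists_eq_sum_of_aeval_mul_pow (hJ : IsOpen J) (hc : J.OrdConnected)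
    (hpos : J ⊆ Set.Ioi 0) {m m' : ℂ} (hm : m ≠ m') (k : ℕ) {f : smoothSpace J}
    (hf : aeval (theta hJ) (((X - C m) * (X - C m')) ^ k) f = 0) :
    ∃ d d' : ℕ → ℂ, f =
      ∑ l ∈ Finset.range k, (d l • logMonomial hpos m l + d' l • logMonomial hpos m' l) := by
  have hcop : IsCoprime ((X - C m) ^ k) ((X - C m') ^ k) :=
    (isCoprime_X_sub_C_of_isUnit_sub (sub_ne_zero.2 hm).isUnit).pow
  rw [mul_pow] at hf
  have hmem : f ∈ LinearMap.ker (aeval (theta hJ) ((X - C m) ^ k))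
      ⊔ LinearMap.ker (aeval (theta hJ) ((X - C m') ^ k)) := by
    rw [sup_ker_aeval_eq_ker_aeval_mul_of_coprime _ hcop]
    exact hf
  obtain ⟨g, hg, g', hg', rfl⟩ := Submodule.mem_sup.1 hmem
  obtain ⟨d, rfl⟩ := exists_eq_sum_of_aeval_X_sub_C_pow_eq_zero hJ hc hpos k hg
  obtain ⟨d', rfl⟩ := exists_eq_sum_of_aeval_X_sub_C_pow_eq_zero hJ hc hpos k hg'
  exact ⟨d, d', Finset.sum_add_distrib.symm⟩

theorem sum_smul_logMonomial_apply (hpos : J ⊆ Set.Ioi 0) (m : ℂ) (n : ℕ) (d : ℕ → ℂ) {x : ℝ}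
    (hx : x ∈ J) :
    (∑ l ∈ Finset.range n, d l • logMonomial hpos m l).1 x
      = ∑ l ∈ Finset.range n, d l * logPow m l x := by
  rw [AddSubmonoidClass.coe_finsetSum, Finset.sum_apply]
  exact Finset.sum_congr rfl fun l _ => by
    rw [← logMonomial_apply hpos m l hx]
    rfl

theorem sum_smul_logMonomial_add_apply (hpos : J ⊆ Set.Ioi 0) (m m' : ℂ) (n : ℕ) (d d' : ℕ → ℂ)
    {x : ℝ} (hx : x ∈ J) :
    (∑ l ∈ Finset.range n, (d l • logMonomial hpos m l + d' l • logMonomial hpos m' l)).1 x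
      = ∑ l ∈ Finset.range n, (d l * logPow m l x + d' l * logPow m' l x) := by
  rw [AddSubmonoidClass.coe_finsetSum, Finset.sum_apply]
  exact Finset.sum_congr rfl fun l _ => by
    rw [← logMonomial_apply hpos m l hx, ← logMonomial_apply hpos m' l hx]
    rfl

/-- The double root `-φ` is why the powers of the logarithm run up to `2k - 1` in this case. -/
theorem eulerPoly_pow_of_disc_eq_zero {a c : ℝ} (h : eulerDisc a c = 0) (k : ℕ) :
    eulerPoly a c ^ k = (X - C ((-eulerPhi a : ℝ) : ℂ)) ^ (2 * k) := by
  rw [eulerPoly_eq_mul a c (s := 0) (by simp [h]), pow_mul]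
  congr 1
  push_cast
  rw [add_zero, sub_zero, sq]

theorem exists_represents_eulerPart (hJ : IsOpen J) (hpos : J ⊆ Set.Ioi 0) (a c : ℝ) (k : ℕ)
    (A B C D E : ℕ → ℝ) :
    ∃ f : smoothSpace J, Represents f (eulerPart a c k A B C D E) ∧
      aeval (theta hJ) (eulerPoly a c ^ k) f = 0 := by
  rcases lt_trichotomy (eulerDisc a c) 0 with h | h | h
  · rw [eulerPoly_eq_mul a c (sq_sqrt_neg_eulerDisc h)]
    -- Euler's formula: `C cos t + D sin t = ((C - iD) e^{it} + (C + iD) e^{-it}) / 2`.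
    refine ⟨_, fun x hx => ?_, aeval_mul_pow_sum hJ hpos _ _ k
      (fun l => ((C l : ℂ) - D l * Complex.I) / 2) (fun l => ((C l : ℂ) + D l * Complex.I) / 2)⟩
    have hx0 : 0 < x := hpos hx
    rw [sum_smul_logMonomial_add_apply hpos _ _ _ _ _ hx, eulerPart, if_neg h.not_gt, if_pos h,
      if_neg h.ne, zero_add, add_zero, Complex.ofReal_sum]
    refine Finset.sum_congr rfl fun l _ => ?_
    have h1 := logPow_ofReal_add_mul_I (-eulerPhi a) √(c - eulerPhi a ^ 2) l hx0
    have h2 := logPow_ofReal_add_mul_I (-eulerPhi a) (-√(c - eulerPhi a ^ 2)) l hx0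
    rw [neg_mul, Real.cos_neg, Real.sin_neg] at h2
    push_cast at h1 h2 ⊢
    rw [neg_mul, ← sub_eq_add_neg] at h2
    rw [h1, h2]
    linear_combination ((x ^ (-eulerPhi a) : ℝ) : ℂ) * (Real.log x : ℂ) ^ l * (-D l) *
      Complex.sin (√(c - eulerPhi a ^ 2) * Real.log x) * Complex.I_sq
  · rw [eulerPoly_pow_of_disc_eq_zero h]
    refine ⟨∑ l ∈ Finset.range (2 * k), (E l : ℂ) • logMonomial hpos ((-eulerPhi a : ℝ) : ℂ) l,
      fun x hx => ?_, ?_⟩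
    · have hx0 : 0 < x := hpos hx
      rw [sum_smul_logMonomial_apply hpos _ _ _ hx, eulerPart, if_neg h.not_gt, if_neg h.not_lt,
        if_pos h, zero_add, zero_add, Complex.ofReal_sum]
      refine Finset.sum_congr rfl fun l _ => ?_
      rw [logPow_ofReal _ _ hx0]
      push_cast
      ring
    · rw [map_sum]
      refine Finset.sum_eq_zero fun l hl => ?_
      rw [map_smul, aeval_X_sub_C_pow_logMonomial hJ hpos _ (Finset.mem_range.1 hl), smul_zero]
  · rw [eulerPoly_eq_mul a c (sq_sqrt_eulerDisc h)]
    refine ⟨_, fun x hx => ?_, aeval_mul_pow_sum hJ hpos _ _ k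
      (fun l => (A l : ℂ)) (fun l => (B l : ℂ))⟩
    have hx0 : 0 < x := hpos hx
    rw [sum_smul_logMonomial_add_apply hpos _ _ _ _ _ hx, eulerPart, if_pos h, if_neg h.not_gt,
      if_neg h.ne', add_zero, add_zero, Complex.ofReal_sum]
    refine Finset.sum_congr rfl fun l _ => ?_
    rw [← Complex.ofReal_neg, ← Complex.ofReal_add, ← Complex.ofReal_sub, logPow_ofReal _ _ hx0,
      logPow_ofReal _ _ hx0, sub_eq_add_neg (-eulerPhi a), Real.rpow_add hx0, Real.rpow_add hx0]
    push_cast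
    ring

/-- The components produced by the coprime splitting need not be real, hence the statement about
real parts. -/
theorem exists_re_eq_eulerPart (hJ : IsOpen J) (hc : J.OrdConnected) (hpos : J ⊆ Set.Ioi 0)
    (a c : ℝ) (k : ℕ) {f : smoothSpace J} (hf : aeval (theta hJ) (eulerPoly a c ^ k) f = 0) :
    ∃ A B C D E : ℕ → ℝ, ∀ x ∈ J, (f.1 x).re = eulerPart a c k A B C D E x := by
  rcases lt_trichotomy (eulerDisc a c) 0 with h | h | h
  · have hs := sq_sqrt_neg_eulerDisc h
    rw [eulerPoly_eq_mul a c hs] at hf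
    -- Equal roots would force the square root `s`, and so the discriminant, to vanish.
    obtain ⟨d, d', rfl⟩ := exists_eq_sum_of_aeval_mul_pow hJ hc hpos (by
      intro h0
      rw [show ((√(c - eulerPhi a ^ 2) : ℝ) : ℂ) * Complex.I = 0 by linear_combination h0 / 2] at hs
      exact h.ne (by exact_mod_cast (by simpa using hs.symm : (eulerDisc a c : ℂ) = 0))) k hf
    -- These are the cosine and sine coefficients of `Re (d e^{it} + d' e^{-it})`.
    refine ⟨0, 0, fun l => (d l).re + (d' l).re, fun l => (d' l).im - (d l).im, 0,
      fun x hx => ?_⟩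
    have hx0 : 0 < x := hpos hx
    rw [sum_smul_logMonomial_add_apply hpos _ _ _ _ _ hx, eulerPart, if_neg h.not_gt, if_pos h,
      if_neg h.ne, zero_add, add_zero, Complex.re_sum]
    refine Finset.sum_congr rfl fun l _ => ?_
    have h1 := logPow_ofReal_add_mul_I (-eulerPhi a) √(c - eulerPhi a ^ 2) l hx0
    have h2 := logPow_ofReal_add_mul_I (-eulerPhi a) (-√(c - eulerPhi a ^ 2)) l hx0
    rw [neg_mul, Real.cos_neg, Real.sin_neg, Complex.ofReal_neg √_, neg_mul, ← sub_eq_add_neg] at h2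
    rw [Complex.ofReal_neg] at h1 h2
    rw [h1, h2, Complex.add_re, mul_left_comm, mul_left_comm (d' l), Complex.re_ofReal_mul,
      Complex.re_ofReal_mul]
    simp only [Complex.mul_re, Complex.add_re, Complex.add_im, Complex.mul_im, Complex.ofReal_re,
      Complex.ofReal_im, Complex.I_re, Complex.I_im]
    ring
  · rw [eulerPoly_pow_of_disc_eq_zero h] at hf
    obtain ⟨d, rfl⟩ := exists_eq_sum_of_aeval_X_sub_C_pow_eq_zero hJ hc hpos _ hf
    refine ⟨0, 0, 0, 0, fun l => (d l).re, fun x hx => ?_⟩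
    have hx0 : 0 < x := hpos hx
    rw [sum_smul_logMonomial_apply hpos _ _ _ hx, eulerPart, if_neg h.not_gt, if_neg h.not_lt,
      if_pos h, zero_add, zero_add, Complex.re_sum]
    refine Finset.sum_congr rfl fun l _ => ?_
    rw [logPow_ofReal _ _ hx0, Complex.re_mul_ofReal, mul_assoc]
  · have hs := sq_sqrt_eulerDisc h
    rw [eulerPoly_eq_mul a c hs] at hf
    obtain ⟨d, d', rfl⟩ := exists_eq_sum_of_aeval_mul_pow hJ hc hpos (by
      intro h0
      rw [show ((√(eulerPhi a ^ 2 - c) : ℝ) : ℂ) = 0 by linear_combination h0 / 2] at hs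
      exact h.ne' (by exact_mod_cast (by simpa using hs.symm : (eulerDisc a c : ℂ) = 0))) k hf
    refine ⟨fun l => (d l).re, fun l => (d' l).re, 0, 0, 0, fun x hx => ?_⟩
    have hx0 : 0 < x := hpos hx
    rw [sum_smul_logMonomial_add_apply hpos _ _ _ _ _ hx, eulerPart, if_pos h, if_neg h.not_gt,
      if_neg h.ne', add_zero, add_zero, Complex.re_sum]
    refine Finset.sum_congr rfl fun l _ => ?_
    rw [← Complex.ofReal_neg, ← Complex.ofReal_add, ← Complex.ofReal_sub, logPow_ofReal _ _ hx0,
      logPow_ofReal _ _ hx0, sub_eq_add_neg (-eulerPhi a), Real.rpow_add hx0, Real.rpow_add hx0, Complex.add_re,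
      Complex.re_mul_ofReal, Complex.re_mul_ofReal]
    ring

/-! ### Assembling the two directions. -/

theorem isEulerSolution_eulerCombination (hJ : IsOpen J) (hpos : J ⊆ Set.Ioi 0) {q : ℕ}
    (α lam : Fin q → ℝ) (k : Fin q → ℕ) (A B C D E : Fin q → ℕ → ℝ) :
    IsEulerSolution α lam k J (eulerCombination α lam k A B C D E) := by
  rw [isEulerSolution_iff hJ hpos]
  choose f hf hf0 using fun v => exists_represents_eulerPart hJ hpos (α v) (lam v) (k v)
    (A v) (B v) (C v) (D v) (E v)
  refine ⟨∑ v, f v, fun x hx => ?_, ?_⟩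
  · rw [AddSubmonoidClass.coe_finsetSum, Finset.sum_apply, eulerCombination_eq_sum,
      Complex.ofReal_sum]
    exact Finset.sum_congr rfl fun v _ => hf v x hx
  · rw [map_sum]
    exact Finset.sum_eq_zero fun v _ =>
      aeval_of_dvd hJ (Finset.dvd_prod_of_mem _ (Finset.mem_univ v)) (hf0 v)

theorem IsEulerSolution.congr (hJ : IsOpen J) (hpos : J ⊆ Set.Ioi 0) {q : ℕ}
    {α lam : Fin q → ℝ} {k : Fin q → ℕ} {u w : ℝ → ℝ} (hw : IsEulerSolution α lam k J w)
    (h : ∀ x ∈ J, u x = w x) : IsEulerSolution α lam k J u := by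
  rw [isEulerSolution_iff hJ hpos] at hw ⊢
  obtain ⟨f, hf, hf0⟩ := hw
  exact ⟨f, fun x hx => by rw [hf x hx, h x hx], hf0⟩

theorem IsEulerSolution.exists_eq_eulerCombination (hJ : IsOpen J) (hc : J.OrdConnected)
    (hpos : J ⊆ Set.Ioi 0) {q : ℕ} {α lam : Fin q → ℝ} {k : Fin q → ℕ}
    (hcop : ∀ v w : Fin q, v ≠ w →
      ¬ ∃ m : ℂ, eulerBeta (α v) (lam v) m = 0 ∧ eulerBeta (α w) (lam w) m = 0)
    {u : ℝ → ℝ} (hu : IsEulerSolution α lam k J u) :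
    ∃ A B C D E : Fin q → ℕ → ℝ, ∀ x ∈ J, u x = eulerCombination α lam k A B C D E x := by
  obtain ⟨f, hf, hf0⟩ := (isEulerSolution_iff hJ hpos α lam k u).1 hu
  obtain ⟨g, hg, rfl⟩ := exists_eq_sum_of_aeval_prod_eq_zero _ _ _
    (fun v _ w _ hvw => (isCoprime_eulerPoly (hcop v w hvw)).pow) hf0
  choose A B C D E h using fun v =>
    exists_re_eq_eulerPart hJ hc hpos (α v) (lam v) (k v) (hg v (Finset.mem_univ v))
  refine ⟨A, B, C, D, E, fun x hx => ?_⟩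
  -- Since `u` is real, it is the sum of the real parts of the components.
  rw [eulerCombination_eq_sum, ← Complex.ofReal_re (u x), ← hf x hx,
    AddSubmonoidClass.coe_finsetSum, Finset.sum_apply, Complex.re_sum]
  exact Finset.sum_congr rfl fun v _ => h v x hx

end

theorem theorem2 (q : ℕ) (α lam : Fin q → ℝ) (k : Fin q → ℕ) (hk : ∀ v, 0 < k v)
    (J : Set ℝ) (hJ : IsOpen J) (hJc : J.OrdConnected) (hJpos : J ⊆ Set.Ioi 0) :
    (∀ A B C D E : Fin q → ℕ → ℝ,
      IsEulerSolution α lam k J (eulerCombination α lam k A B C D E)) ∧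
    ((∀ v w : Fin q, v ≠ w →
        ¬ ∃ m : ℂ, eulerBeta (α v) (lam v) m = 0 ∧ eulerBeta (α w) (lam w) m = 0) →
      ∀ u : ℝ → ℝ, IsEulerSolution α lam k J u ↔
        ∃ A B C D E : Fin q → ℕ → ℝ,
          ∀ x ∈ J, u x = eulerCombination α lam k A B C D E x) := by
  refine ⟨isEulerSolution_eulerCombination hJ hJpos α lam k, fun hcop u =>
    ⟨fun hu => hu.exists_eq_eulerCombination hJ hJc hJpos hcop, ?_⟩⟩
  rintro ⟨A, B, C, D, E, h⟩
  exact (isEulerSolution_eulerCombination hJ hJpos α lam k A B C D E).congr hJ hJpos h
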